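/- A \emph{pseudovariety of finite semigroups} is a non-empty class of finite (non-empty) semigroups closed under subsemigroups, quotients (up to isomorphism) and finite direct products. A language $L \subseteq A^+$ is \emph{recognized} by a semigroup $T$ if $L = f^{-1}(R)$ for some morphism $f \colon A^+ \to T$ and some $R \subseteq T$. Let $\mathbf{V}$ be a fixed pseudovariety of finite semigroups which is not the class $\mathbf{S}$ of all finite semigroups. Consider the following decision problem. The input consists of a finite semigroup $S$, a morphism $h \colon A^+ \to S$ from the free semigroup over a finite non-empty alphabet $A$, and a subset $P \subseteq S$; the question is whether the language $h^{-1}(P)$ is recognized by some semigroup in $\mathbf{V}$. Then this problem is $\mathsf{NL}$-hard under $\mathsf{AC}^0$ many-one reductions. Here an input with $|S| = N$ and $|A| = k$ is encoded by the bit string consisting of $1^N 0\, 1^k 0$, the multiplication table of $S$ in row-major order, the list of the images under $h$ of the letters (each element of $S$ being a number in $\{1, \dots, N\}$ written with $\lceil \log_2 (N+1) \rceil$ bits), and the characteristic sequence of $P$ (of length $N$). The class $\mathsf{NL}$ consists of the languages over $\{0,1\}$ accepted by nondeterministic Turing machines with a two-way read-only input tape and $O(\log n)$ cells of work tape. An $\mathsf{AC}^0$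 many-one reduction from $L$ to $L'$ is a function $f \colon \{0,1\}^* \to \{0,1\}^*$ such that $w \in L \Leftrightarrow f(w) \in L'$ for all $w$, and such that $f$ is computed by a family of Boolean circuits, one for each input length, of constant depth and polynomial size, with AND and OR gates of unbounded fan-in (NOT gates are allowed and not counted). -/

import Mathlib

/-! ## Pseudovarieties of finite semigroups and recognition of languages -/

/-- A pseudovariety of finite semigroups: a non-empty class of finite (non-empty) semigroups
closed under subsemigroups, quotients and finite direct products. Quotients are taken up to
isomorphism, that is, as images under surjective morphisms. The empty product is covered, because
the one-element semigroup is a quotient of every member. -/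
@[ext]
structure Pseudovariety where
  Mem : (S : Type) → [Semigroup S] → Prop
  finite_of_mem : ∀ (S : Type) [Semigroup S], Mem S → Finite S
  nonempty_of_mem : ∀ (S : Type) [Semigroup S], Mem S → Nonempty S
  exists_mem : ∃ (S : Type) (_ : Semigroup S), Mem S
  mem_subsemigroup : ∀ (S : Type) [Semigroup S], Mem S →
    ∀ T : Subsemigroup S, (T : Set S).Nonempty → Mem T
  mem_quotient : ∀ (S T : Type) [Semigroup S] [Semigroup T], Mem S →
    ∀ f : S →ₙ* T, Function.Surjective f → Mem T
  mem_prod : ∀ (S T : Type) [Semigroup S] [Semigroup T], Mem S → Mem T → Mem (S × T)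

/-- The pseudovariety of all finite semigroups. -/
def Pseudovariety.all : Pseudovariety where
  Mem S _ := Finite S ∧ Nonempty S
  finite_of_mem _ _ h := h.1
  nonempty_of_mem _ _ h := h.2
  exists_mem := ⟨Unit, inferInstance, inferInstance, inferInstance⟩
  mem_subsemigroup _ _ h _ hT := by
    have := h.1
    exact ⟨inferInstance, hT.to_subtype⟩
  mem_quotient _ _ _ _ h f hf := by
    have := h.1
    have := h.2
    exact ⟨Finite.of_surjective f hf, Nonempty.map f inferInstance⟩
  mem_prod _ _ _ _ h h' := by
    have := h.1
    have := h.2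
    have := h'.1
    have := h'.2
    exact ⟨inferInstance, inferInstance⟩

/-- The semigroup `T` recognizes `L ⊆ A⁺`: there are a morphism `f : A⁺ → T` and a set `R ⊆ T`
such that `L = f⁻¹(R)`. -/
def SemigroupRecognizes {A : Type} (T : Type) [Semigroup T] (L : Set (FreeSemigroup A)) : Prop :=
  ∃ (f : FreeSemigroup A →ₙ* T) (R : Set T), f ⁻¹' R = L

/-- `L ⊆ A⁺` is recognized by some semigroup in `V`. -/
def Pseudovariety.Recognizes (V : Pseudovariety) {A : Type} (L : Set (FreeSemigroup A)) : Prop :=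
  ∃ (T : Type) (_ : Semigroup T), V.Mem T ∧ SemigroupRecognizes T L

/-! ## The decision problem and the encoding of its inputs -/

/-- An input of the problem: a finite semigroup `S` with elements `0, …, card - 1`, a morphism
`h : A⁺ → S` given by the images of the letters `0, …, alph - 1` of the alphabet `A`, and a
subset `P` of `S`. -/
structure MorphismInput where
  card : ℕ
  card_pos : 0 < card
  mul : Fin card → Fin card → Fin card
  mul_assoc : ∀ x y z, mul (mul x y) z = mul x (mul y z)
  alph : ℕ
  alph_pos : 0 < alph
  letter : Fin alph → Fin card
  P : Finset (Fin card)

namespace MorphismInput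

/-- The underlying set of the semigroup `S` (a copy of `Fin card` without its modular
arithmetic). -/
def Carrier (I : MorphismInput) : Type := Fin I.card

instance (I : MorphismInput) : Semigroup I.Carrier where
  mul := I.mul
  mul_assoc := I.mul_assoc

/-- The morphism `h : A⁺ → S`. -/
def hom (I : MorphismInput) : FreeSemigroup (Fin I.alph) →ₙ* I.Carrier :=
  FreeSemigroup.lift (fun a => (I.letter a : I.Carrier))

/-- The language `h⁻¹(P)`. -/
def language (I : MorphismInput) : Set (FreeSemigroup (Fin I.alph)) :=
  I.hom ⁻¹' {x : I.Carrier | (show Fin I.card from x) ∈ I.P}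

/-- Binary code of an element on `⌈log₂ (N + 1)⌉` bits; the elements of a semigroup with `N`
elements are represented by the integers `1, …, N`. -/
def elemCode (N : ℕ) (i : Fin N) : List Bool :=
  List.ofFn (fun j : Fin (Nat.clog 2 (N + 1)) => Nat.testBit (i.val + 1) j)

/-- The encoding of an input: cardinality of `S` and of `A` in unary, each followed by a
delimiter, the multiplication table of `S` in row-major order, the images of the letters, and the
characteristic sequence of `P`. -/
def encode (I : MorphismInput) : List Bool :=
  List.replicate I.card true ++ [false] ++
  List.replicate I.alph true ++ [false] ++
  ((List.finRange I.card).flatMap fun x =>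
    (List.finRange I.card).flatMap fun y => elemCode I.card (I.mul x y)) ++
  ((List.finRange I.alph).flatMap fun a => elemCode I.card (I.letter a)) ++
  (List.finRange I.card).map fun x => decide (x ∈ I.P)

end MorphismInput

/-- The problem of deciding whether `h⁻¹(P)` is recognized by a semigroup in `V`, as a language
of bit strings. -/
def languageMembershipProblem (V : Pseudovariety) : Set (List Bool) :=
  {w | ∃ I : MorphismInput, I.encode = w ∧ V.Recognizes I.language}

/-! ## Nondeterministic logarithmic space -/

/-- Contents of a cell of the read-only input tape, which carries the input word between two
end markers. -/
inductive InputSymbol where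
  | leftEnd : InputSymbol
  | bit : Bool → InputSymbol
  | rightEnd : InputSymbol

/-- The input tape for `w` has the left end marker in cell `0`, the word `w` in the cells
`1, …, |w|` and the right end marker in cell `|w| + 1`. -/
def inputSymbolAt (w : List Bool) : ℕ → InputSymbol
  | 0 => .leftEnd
  | p + 1 =>
    match w[p]? with
    | some b => .bit b
    | none => .rightEnd

/-- Head movements. -/
inductive HeadMove where
  | left : HeadMove
  | stay : HeadMove
  | right : HeadMove

/-- New head position; a head in cell `0` stays there when it is moved to the left. -/
def HeadMove.apply : HeadMove → ℕ → ℕ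
  | .left, p => p - 1
  | .stay, p => p
  | .right, p => p + 1

/-- A nondeterministic Turing machine over the input alphabet `{0, 1}`, with a two-way read-only
input tape and a one-sided infinite work tape. -/
structure NTM where
  State : Type
  Work : Type
  finite_state : Finite State
  finite_work : Finite Work
  blank : Work
  start : State
  accept : Set State
  /-- From a state, an input symbol and a work tape symbol: the possible new states, symbols
  written on the work tape, movements of the input head and movements of the work head. -/
  trans : State → InputSymbol → Work → Set (State × Work × HeadMove × HeadMove)

namespace NTM

/-- Configurations. -/
structure Cfg (M : NTM) where
  state : M.State
  inputHead : ℕ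
  tape : ℕ → M.Work
  workHead : ℕ

/-- The initial configuration; the work tape is blank. -/
def init (M : NTM) : M.Cfg := ⟨M.start, 0, fun _ => M.blank, 0⟩

/-- One computation step on the input `w`. The input head does not leave the cells
`0, …, |w| + 1`. -/
def Step (M : NTM) (w : List Bool) (c c' : M.Cfg) : Prop :=
  ∃ (q : M.State) (a : M.Work) (mi mw : HeadMove),
    (q, a, mi, mw) ∈ M.trans c.state (inputSymbolAt w c.inputHead) (c.tape c.workHead) ∧
    c' = ⟨q, min (mi.apply c.inputHead) (w.length + 1),
          Function.update c.tape c.workHead a, mw.apply c.workHead⟩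

/-- `c` is reachable from the initial configuration on the input `w`. -/
def Reaches (M : NTM) (w : List Bool) (c : M.Cfg) : Prop :=
  Relation.ReflTransGen (M.Step w) M.init c

/-- `M` accepts `w` if some computation reaches an accepting state. -/
def Accepts (M : NTM) (w : List Bool) : Prop :=
  ∃ c : M.Cfg, M.Reaches w c ∧ c.state ∈ M.accept

/-- On every input of length `n`, no computation visits more than `O(log n)` cells of the work
tape (`k` cells, for a constant `k`, if `n ≤ 1`). -/
def LogSpaceBounded (M : NTM) : Prop :=
  ∃ k : ℕ, ∀ (w : List Bool) (c : M.Cfg), M.Reaches w c →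
    c.workHead < k * (Nat.log 2 w.length + 1)

end NTM

/-- The class `NL`. -/
def IsNL (L : Set (List Bool)) : Prop :=
  ∃ M : NTM, M.LogSpaceBounded ∧ ∀ w, w ∈ L ↔ M.Accepts w

/-! ## `AC⁰` reductions -/

/-- A Boolean circuit with `n` inputs, `m` outputs, and AND and OR gates of unbounded fan-in.
NOT gates are free: each incoming wire of a gate, and each output, carries a sign (`true` for the
plain value, `false` for the negated value). All gate-to-gate wires strictly increase the level,
so that the circuit is acyclic, and it has depth at most `d` if all levels are below `d`. -/
structure BoolCircuit (n m : ℕ) where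
  Gate : Type
  fintypeGate : Fintype Gate
  /-- `true` for an AND gate, `false` for an OR gate. -/
  isAnd : Gate → Bool
  /-- Signed wires coming from the inputs. -/
  inputWires : Gate → Set (Fin n × Bool)
  /-- Signed wires coming from other gates. -/
  gateWires : Gate → Set (Gate × Bool)
  level : Gate → ℕ
  level_lt : ∀ {g g' : Gate} {b : Bool}, (g', b) ∈ gateWires g → level g' < level g
  /-- Signed source (an input or a gate) of each output. -/
  output : Fin m → (Fin n ⊕ Gate) × Bool

namespace BoolCircuit

variable {n m : ℕ}

/-- The number of gates. -/
def size (C : BoolCircuit n m) : ℕ := @Fintype.card C.Gate C.fintypeGate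

/-- The circuit has depth at most `d`. -/
def DepthLE (C : BoolCircuit n m) (d : ℕ) : Prop := ∀ g, C.level g < d

open Classical in
/-- The value of a gate on the input `x`. A wire with sign `b` from a source of value `v`
carries the value true exactly if `v = b`. -/
noncomputable def gateVal (C : BoolCircuit n m) (x : Fin n → Bool) (g : C.Gate) : Bool :=
  if C.isAnd g = true then
    decide ((∀ i b, (i, b) ∈ C.inputWires g → x i = b) ∧
      ∀ g' b, (_ : (g', b) ∈ C.gateWires g) → C.gateVal x g' = b)
  else
    decide ((∃ i b, (i, b) ∈ C.inputWires g ∧ x i = b) ∨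
      ∃ g' b, ∃ _ : (g', b) ∈ C.gateWires g, C.gateVal x g' = b)
termination_by C.level g
decreasing_by all_goals exact C.level_lt (by assumption)

/-- The output of the circuit on the input `x`. -/
noncomputable def eval (C : BoolCircuit n m) (x : Fin n → Bool) (j : Fin m) : Bool :=
  Sum.elim x (C.gateVal x) (C.output j).1 == (C.output j).2

end BoolCircuit

/-- `f` is computed by a family of unbounded fan-in Boolean circuits of constant depth and
polynomial size, one circuit for each input length. -/
def IsAC0Computable (f : List Bool → List Bool) : Prop :=
  ∃ (d : ℕ) (p : Polynomial ℕ), ∀ n : ℕ, ∃ (m : ℕ) (C : BoolCircuit n m),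
    C.DepthLE d ∧ C.size ≤ p.eval n ∧ m ≤ p.eval n ∧
    ∀ x : Fin n → Bool, f (List.ofFn x) = List.ofFn (C.eval x)

/-- `L` is many-one reducible to `L'` by an `AC⁰`-computable function. -/
def AC0Reducible (L L' : Set (List Bool)) : Prop :=
  ∃ f : List Bool → List Bool, IsAC0Computable f ∧ ∀ w, w ∈ L ↔ f w ∈ L'

/-- `NL`-hardness under `AC⁰` reductions. -/
def IsNLHard (L' : Set (List Bool)) : Prop :=
  ∀ L : Set (List Bool), IsNL L → AC0Reducible L L'

/-! ## Recognition by members of a pseudovariety -/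

namespace Pseudovariety

/-! Some finite semigroup `T` lies outside `V`, and some fibre of the evaluation `T⁺ → T` is then
not recognized by `V`: if all fibres were, a finite product in `V` would recognize them jointly and
`T` would be a quotient of a subsemigroup of it (`exists_not_recognizes`).

This fibre is planted behind a graph. In the Rees matrix semigroup over `WithOne T`, edges of the
graph carry the label `1`, and each `x : T` labels an extra edge from `τ` back to `σ`. If `σ`
reaches `τ`, loops at `σ` spell all of `T`, and the words with value `(σ, t, σ)` pull back to the
bad fibre. Otherwise no word has that value and the language is empty
(`recognizes_loopLanguage_iff`). A positive instance thus corresponds to non-reachability, so a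
language in `NL` must first be described by non-reachability in a graph of polynomial size.
Inductive counting does this (`IsNL.exists_graph_compl`).

The semigroup and the accepting set depend only on the input length, and only the images of edge
letters vary with the input. Each edge of the graph is decided by at most one input bit, a property
that survives inductive counting (`isLiteral_step`). Every output bit is therefore a constant or a
possibly negated input bit, which is well within `AC⁰` (`AC0Reducible.of_literals`). -/

theorem Recognizes.preimage {V : Pseudovariety} {A B : Type} {L : Set (FreeSemigroup B)}
    (hL : V.Recognizes L) (φ : FreeSemigroup A →ₙ* FreeSemigroup B) :
    V.Recognizes (φ ⁻¹' L) := by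
  obtain ⟨T, _, hT, f, R, rfl⟩ := hL
  exact ⟨T, _, hT, f.comp φ, R, rfl⟩

theorem recognizes_empty (V : Pseudovariety) (A : Type) :
    V.Recognizes (∅ : Set (FreeSemigroup A)) := by
  obtain ⟨T, _, hT⟩ := V.exists_mem
  obtain ⟨t⟩ := V.nonempty_of_mem T hT
  exact ⟨T, _, hT, FreeSemigroup.lift fun _ => t, ∅, rfl⟩

theorem exists_notMem {V : Pseudovariety} (hV : V ≠ Pseudovariety.all) :
    ∃ (T : Type) (_ : Semigroup T), Finite T ∧ Nonempty T ∧ ¬ V.Mem T := by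
  by_contra! h
  refine hV (Pseudovariety.ext ?_)
  funext S _
  exact propext ⟨fun hS => ⟨V.finite_of_mem S hS, V.nonempty_of_mem S hS⟩,
    fun hS => h S _ hS.1 hS.2⟩

/-- Finitely many recognizable languages are recognized by a common morphism. -/
theorem exists_common_morphism (V : Pseudovariety) {A ι : Type} (L : ι → Set (FreeSemigroup A))
    (hL : ∀ i, V.Recognizes (L i)) (F : Finset ι) :
    ∃ (T : Type) (_ : Semigroup T) (f : FreeSemigroup A →ₙ* T), V.Mem T ∧
      ∀ u v, f u = f v → ∀ i ∈ F, u ∈ L i → v ∈ L i := by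
  classical
  induction F using Finset.induction_on with
  | empty =>
    obtain ⟨T, _, hT⟩ := V.exists_mem
    obtain ⟨t⟩ := V.nonempty_of_mem T hT
    exact ⟨T, _, FreeSemigroup.lift fun _ => t, hT, by simp⟩
  | insert i F _ ih =>
    obtain ⟨T, _, f, hT, hf⟩ := ih
    obtain ⟨U, _, hU, g, R, hg⟩ := hL i
    refine ⟨T × U, _, f.prod g, V.mem_prod T U hT hU, fun u v huv j hj hu => ?_⟩
    have h1 : f u = f v := congrArg Prod.fst huv
    have h2 : g u = g v := congrArg Prod.snd huv
    rcases Finset.mem_insert.1 hj with rfl | hj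
    · rw [← hg] at hu ⊢
      simpa [← h2] using hu
    · exact hf u v h1 j hj hu

/-- The evaluation of nonempty words over a semigroup. -/
def evalHom (T : Type) [Semigroup T] : FreeSemigroup T →ₙ* T := FreeSemigroup.lift id

/-- If a morphism into a member of `V` separates all fibres of the evaluation, then its kernel
refines that of the evaluation, which therefore factors through its image and exhibits `T` as a
quotient. -/
theorem exists_not_recognizes (V : Pseudovariety) (T : Type) [Semigroup T] [Finite T]
    [Nonempty T] (hT : ¬ V.Mem T) : ∃ t : T, ¬ V.Recognizes (evalHom T ⁻¹' {t}) := by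
  by_contra! h
  have := Fintype.ofFinite T
  obtain ⟨U, _, f, hU, hf⟩ := V.exists_common_morphism _ h Finset.univ
  have key : ∀ u v, f u = f v → evalHom T u = evalHom T v := fun u v huv =>
    (hf u v huv (evalHom T u) (Finset.mem_univ _) rfl).symm
  have hsr : V.Mem f.srange := by
    refine V.mem_subsemigroup U hU _ ?_
    obtain ⟨t⟩ := ‹Nonempty T›
    exact ⟨f (FreeSemigroup.of t), FreeSemigroup.of t, rfl⟩
  -- By `key`, the value of the evaluation does not depend on the chosen preimage.
  choose pre hpre using fun y : f.srange => MulHom.mem_srange.1 y.2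
  let q : f.srange →ₙ* T :=
    { toFun := fun y => evalHom T (pre y)
      map_mul' := fun x y => by
        rw [← map_mul]
        apply key
        rw [hpre, map_mul, hpre, hpre]
        rfl }
  refine hT (V.mem_quotient _ T hsr q fun t => ⟨⟨f (FreeSemigroup.of t), _, rfl⟩, ?_⟩)
  exact (key _ (FreeSemigroup.of t) (hpre _)).trans (FreeSemigroup.lift_of _ _)

end Pseudovariety

/-! ## The semigroup of labelled paths -/

/-- The Rees matrix semigroup with zero of triples `(a, m, b)`, where `m` ranges over the monoid
`M` and the sandwich matrix is the identity. -/
inductive ReesZero (Q M : Type) : Type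
  | zero
  | triple (a : Q) (m : M) (b : Q)

namespace ReesZero

variable {Q M T : Type}

open Classical in
/-- Multiplication of triples. -/
noncomputable def mul [Monoid M] : ReesZero Q M → ReesZero Q M → ReesZero Q M
  | triple a m b, triple c m' d => if b = c then triple a (m * m') d else zero
  | _, _ => zero

noncomputable instance [Monoid M] : Semigroup (ReesZero Q M) where
  mul := mul
  mul_assoc := by
    rintro (_ | ⟨a, m, b⟩) (_ | ⟨c, m', d⟩) (_ | ⟨e, m'', f⟩) <;> try rfl
    · change mul (mul _ _) _ = mul _ (mul _ _)
      by_cases h1 : b = c <;> simp [mul, h1]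
    · change mul (mul _ _) _ = mul _ (mul _ _)
      by_cases h1 : b = c <;> by_cases h2 : d = e <;> simp [mul, h1, h2, mul_assoc]

/-- The elements as an optional triple. -/
def toOption : ReesZero Q M → Option (Q × M × Q)
  | zero => none
  | triple a m b => some (a, m, b)

theorem toOption_injective : Function.Injective (toOption (Q := Q) (M := M)) := by
  rintro (_ | ⟨a, m, b⟩) (_ | ⟨c, m', d⟩) h <;> simp_all [toOption]

instance [Finite Q] [Finite M] : Finite (ReesZero Q M) :=
  Finite.of_injective _ toOption_injective

theorem card_le [Finite Q] [Finite M] :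
    Nat.card (ReesZero Q M) ≤ Nat.card Q * (Nat.card M * Nat.card Q) + 1 := by
  simpa [Finite.card_option, Nat.card_prod] using
    Nat.card_le_card_of_injective _ (toOption_injective (Q := Q) (M := M))

theorem triple_mul_triple [Monoid M] (a b d : Q) (m m' : M) :
    triple a m b * triple b m' d = triple a (m * m') d :=
  if_pos rfl

theorem triple_mul_triple_of_ne [Monoid M] {a b c d : Q} {m m' : M} (h : b ≠ c) :
    triple a m b * triple c m' d = zero :=
  if_neg h

open Classical in
/-- The images of the letters: the edges of the graph `E` are labelled by `1`, and for each
element `x` of `T` there is an edge from `τ` to `σ` labelled by `x`. -/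
noncomputable def letter [Semigroup T] (E : Q → Q → Prop) (σ τ : Q) :
    (Q × Q) ⊕ T → ReesZero Q (WithOne T)
  | .inl (a, b) => if E a b then triple a 1 b else zero
  | .inr x => triple τ (x : WithOne T) σ

/-- The language of the words evaluating to `(σ, t, σ)`. -/
def loopLanguage [Semigroup T] (E : Q → Q → Prop) (σ τ : Q) (t : T) :
    Set (FreeSemigroup ((Q × Q) ⊕ T)) :=
  FreeSemigroup.lift (letter E σ τ) ⁻¹' {triple σ (t : WithOne T) σ}

variable [Semigroup T] {E : Q → Q → Prop} {σ τ : Q}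

/-- Follow a path to `τ`, whose edges contribute only `1`, and close it with the letter `x`. -/
theorem exists_word (x : T) {a : Q} (h : Relation.ReflTransGen E a τ) :
    ∃ w, FreeSemigroup.lift (letter E σ τ) w = triple a (x : WithOne T) σ := by
  induction h using Relation.ReflTransGen.head_induction_on with
  | refl => exact ⟨FreeSemigroup.of (.inr x), FreeSemigroup.lift_of _ _⟩
  | @head a b hab _ ih =>
    obtain ⟨w, hw⟩ := ih
    refine ⟨FreeSemigroup.of (.inl (a, b)) * w, ?_⟩
    rw [map_mul, hw, FreeSemigroup.lift_of, letter, if_pos hab, triple_mul_triple, one_mul]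

/-- Substituting for each letter `x` a word with value `(σ, x, σ)` turns membership in the loop
language into evaluation to `t`, and recognition is preserved by inverse morphisms. -/
theorem not_recognizes_loopLanguage {V : Pseudovariety} {t : T}
    (ht : ¬ V.Recognizes (Pseudovariety.evalHom T ⁻¹' {t}))
    (h : Relation.ReflTransGen E σ τ) : ¬ V.Recognizes (loopLanguage E σ τ t) := by
  choose p hp using fun x : T => exists_word (σ := σ) (E := E) x h
  intro hrec
  refine ht ?_
  convert hrec.preimage (FreeSemigroup.lift p) using 1
  have key : ∀ u, FreeSemigroup.lift (letter E σ τ) (FreeSemigroup.lift p u) =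
      triple σ (Pseudovariety.evalHom T u : WithOne T) σ := by
    intro u
    induction u using FreeSemigroup.recOnMul with
    | ih1 x =>
      rw [FreeSemigroup.lift_of, hp]
      rfl
    | ih2 x y hx hy =>
      rw [map_mul, map_mul, hx, hy, triple_mul_triple, map_mul, WithOne.coe_mul]
  ext u
  simp only [loopLanguage, Set.mem_preimage, Set.mem_singleton_iff, key]
  refine ⟨fun h => by rw [h], fun h => WithOne.coe_injective (ReesZero.triple.inj h).2.1⟩

/-- The elements of the path semigroup that the edges of `E` can account for. -/
def Realizable (E : Q → Q → Prop) (τ : Q) (s : ReesZero Q (WithOne T)) : Prop :=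
  ∀ a m b, s = triple a m b → (m = 1 → Relation.ReflTransGen E a b) ∧
    (m ≠ 1 → Relation.ReflTransGen E a τ)

/-- The adjoined unit is new even if `T` has one, so a product is `1` only if both factors are, and
then paths concatenate. Otherwise the first factor with label other than `1` supplies the path to
`τ`. -/
theorem Realizable.mul {x y : ReesZero Q (WithOne T)} (hx : Realizable E τ x)
    (hy : Realizable E τ y) : Realizable E τ (x * y) := by
  intro a m b h
  rcases x with _ | ⟨c, k, d⟩
  · nomatch h
  rcases y with _ | ⟨e, l, f⟩
  · nomatch h
  by_cases hde : d = e
  · subst hde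
    rw [triple_mul_triple] at h
    obtain ⟨rfl, rfl, rfl⟩ := ReesZero.triple.inj h
    have hx' := hx _ _ _ rfl
    have hy' := hy _ _ _ rfl
    induction k using WithOne.recOneCoe with
    | one => simpa using ⟨fun h => (hx'.1 rfl).trans (hy'.1 h), fun h => (hx'.1 rfl).trans (hy'.2 h)⟩
    | coe k =>
      have := hx'.2 WithOne.coe_ne_one
      induction l using WithOne.recOneCoe with
      | one => simpa using this
      | coe l => exact ⟨fun h => absurd h (by rw [← WithOne.coe_mul]; exact WithOne.coe_ne_one), fun _ => this⟩
  · rw [triple_mul_triple_of_ne hde] at h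
    nomatch h

theorem realizable_lift (w : FreeSemigroup ((Q × Q) ⊕ T)) :
    Realizable E τ (FreeSemigroup.lift (letter E σ τ) w) := by
  induction w using FreeSemigroup.recOnMul with
  | ih1 x =>
    rw [FreeSemigroup.lift_of]
    intro a m b h
    rcases x with ⟨c, d⟩ | x
    · rw [letter] at h
      split_ifs at h with hE
      · obtain ⟨rfl, rfl, rfl⟩ := ReesZero.triple.inj h
        exact ⟨fun _ => .single hE, fun h => absurd rfl h⟩
    · obtain ⟨rfl, rfl, rfl⟩ := ReesZero.triple.inj h
      exact ⟨fun h => absurd h WithOne.coe_ne_one, fun _ => .refl⟩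
  | ih2 x y hx hy =>
    rw [map_mul]
    exact hx.mul hy

theorem recognizes_loopLanguage_iff {V : Pseudovariety} {t : T}
    (ht : ¬ V.Recognizes (Pseudovariety.evalHom T ⁻¹' {t})) :
    V.Recognizes (loopLanguage E σ τ t) ↔ ¬ Relation.ReflTransGen E σ τ := by
  refine ⟨fun h hr => not_recognizes_loopLanguage ht hr h, fun hr => ?_⟩
  rw [show loopLanguage E σ τ t = ∅ from ?_]
  · exact V.recognizes_empty _
  ext w
  simp only [loopLanguage, Set.mem_preimage, Set.mem_singleton_iff, Set.mem_empty_iff_false,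
    iff_false]
  intro hw
  exact hr ((realizable_lift w _ _ _ hw).2 WithOne.coe_ne_one)

end ReesZero

/-! ## Inductive counting -/

namespace InductiveCounting

variable {N : ℕ}

/-- The vertices reachable from `s` in at most `i` steps. -/
def Within (E : Fin N → Fin N → Prop) (s : Fin N) : ℕ → Set (Fin N)
  | 0 => {s}
  | i + 1 => {y | ∃ x ∈ Within E s i, x = y ∨ E x y}

open Classical in
/-- The number of vertices below `v` satisfying `p`. -/
noncomputable def countBelow (p : Fin N → Prop) (v : ℕ) : ℕ :=
  (Finset.univ.filter fun x : Fin N => p x ∧ x.val < v).card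

theorem countBelow_zero (p : Fin N → Prop) : countBelow p 0 = 0 := by
  simp [countBelow]

theorem countBelow_le (p : Fin N → Prop) (v : ℕ) : countBelow p v ≤ N :=
  (Finset.card_le_univ _).trans (Fintype.card_fin N).le

theorem countBelow_succ_of_pos {p : Fin N → Prop} {v : Fin N} (h : p v) :
    countBelow p (v + 1) = countBelow p v + 1 := by
  rw [countBelow, countBelow, ← Finset.card_insert_of_notMem (a := v) (by simp)]
  congr 1
  ext x
  simp only [Finset.mem_filter, Finset.mem_univ, true_and, Finset.mem_insert, Fin.ext_iff]
  constructor
  · rintro ⟨h1, h2⟩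
    by_cases h3 : x.val = v.val
    · exact .inl h3
    · exact .inr ⟨h1, by omega⟩
  · rintro (h1 | ⟨h1, h2⟩)
    · exact ⟨by rwa [Fin.ext h1], by omega⟩
    · exact ⟨h1, by omega⟩

theorem countBelow_succ_of_neg {p : Fin N → Prop} {v : Fin N} (h : ¬ p v) :
    countBelow p (v + 1) = countBelow p v := by
  rw [countBelow, countBelow]
  congr 1
  ext x
  simp only [Finset.mem_filter, Finset.mem_univ, true_and]
  constructor
  · rintro ⟨h1, h2⟩
    by_cases h3 : x.val = v.val
    · exact absurd (Fin.ext h3 ▸ h1) h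
    · exact ⟨h1, by omega⟩
  · rintro ⟨h1, h2⟩
    exact ⟨h1, by omega⟩

/-- The number of vertices below `v` reachable in at most `i` steps. -/
noncomputable def cnt (E : Fin N → Fin N → Prop) (s : Fin N) (i v : ℕ) : ℕ :=
  countBelow (fun x => x ∈ Within E s i) v

/-- The number of vertices below `u` reachable in at most `i` steps which are neither equal to
nor adjacent to `v`. -/
noncomputable def cntAvoid (E : Fin N → Fin N → Prop) (s : Fin N) (i u : ℕ) (v : Fin N) : ℕ :=
  countBelow (fun x => x ∈ Within E s i ∧ x ≠ v ∧ ¬ E x v) u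

variable {E : Fin N → Fin N → Prop} {s : Fin N}

theorem cnt_le (i v : ℕ) : cnt E s i v ≤ N := countBelow_le _ _

theorem cnt_zero (i : ℕ) : cnt E s i 0 = 0 := countBelow_zero _

theorem cnt_succ_of_mem {i : ℕ} {v : Fin N} (h : v ∈ Within E s i) :
    cnt E s i (v + 1) = cnt E s i v + 1 := countBelow_succ_of_pos h

theorem cnt_succ_of_notMem {i : ℕ} {v : Fin N} (h : v ∉ Within E s i) :
    cnt E s i (v + 1) = cnt E s i v := countBelow_succ_of_neg h

theorem cntAvoid_le (i u : ℕ) (v : Fin N) : cntAvoid E s i u v ≤ N := countBelow_le _ _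

theorem cntAvoid_zero (i : ℕ) (v : Fin N) : cntAvoid E s i 0 v = 0 := countBelow_zero _

theorem cntAvoid_succ_of_mem {i : ℕ} {u v : Fin N} (h : u ∈ Within E s i) (h1 : u ≠ v)
    (h2 : ¬ E u v) : cntAvoid E s i (u + 1) v = cntAvoid E s i u v + 1 :=
  countBelow_succ_of_pos (p := fun x => x ∈ Within E s i ∧ x ≠ v ∧ ¬ E x v) ⟨h, h1, h2⟩

theorem cntAvoid_succ_of_notMem {i : ℕ} {u v : Fin N} (h : u ∉ Within E s i) :
    cntAvoid E s i (u + 1) v = cntAvoid E s i u v :=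
  countBelow_succ_of_neg (p := fun x => x ∈ Within E s i ∧ x ≠ v ∧ ¬ E x v) fun hu => h hu.1

theorem cntAvoid_le_succ (i : ℕ) (u v : Fin N) :
    cntAvoid E s i u v ≤ cntAvoid E s i (u + 1) v := by
  classical
  rw [cntAvoid, cntAvoid, countBelow, countBelow]
  refine Finset.card_le_card fun x => ?_
  simp only [Finset.mem_filter, Finset.mem_univ, true_and]
  exact fun h => ⟨h.1, by omega⟩

theorem cnt_zero_right : cnt E s 0 N = 1 := by
  classical
  rw [cnt, countBelow, Finset.card_eq_one]
  exact ⟨s, by ext x; simp [Within]⟩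

theorem cntAvoid_eq_of_notMem {i : ℕ} {v : Fin N} (h : v ∉ Within E s (i + 1)) :
    cntAvoid E s i N v = cnt E s i N := by
  classical
  rw [cnt, cntAvoid, countBelow, countBelow]
  congr 1
  ext x
  simp only [Finset.mem_filter, Finset.mem_univ, true_and, x.2, and_true, and_iff_left_iff_imp]
  exact fun hx => ⟨fun e => h ⟨x, hx, .inl e⟩, fun e => h ⟨x, hx, .inr e⟩⟩

/-- The counting certificate: the vertices avoiding `v` form a subset of those within `i` steps, so
equal size forces equality and leaves no predecessor for `v`. -/
theorem notMem_of_cnt_le {i : ℕ} {v : Fin N} (h : cnt E s i N ≤ cntAvoid E s i N v) :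
    v ∉ Within E s (i + 1) := by
  classical
  rintro ⟨x, hx, hxv⟩
  rw [cnt, cntAvoid, countBelow, countBelow] at h
  have := Finset.eq_of_subset_of_card_le (fun y => by
    simp only [Finset.mem_filter, Finset.mem_univ, true_and]
    exact fun h => ⟨h.1.1, h.2⟩) h
  have hx' : x ∈ Finset.univ.filter fun x : Fin N => x ∈ Within E s i ∧ x.val < N := by simp [hx]
  rw [← this] at hx'
  simp only [Finset.mem_filter, Finset.mem_univ, true_and] at hx'
  exact hxv.elim hx'.1.2.1 hx'.1.2.2

theorem within_subset_succ (i : ℕ) : Within E s i ⊆ Within E s (i + 1) :=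
  fun x hx => ⟨x, hx, .inl rfl⟩

theorem reachable_of_within {i : ℕ} {x : Fin N} (h : x ∈ Within E s i) :
    Relation.ReflTransGen E s x := by
  induction i generalizing x with
  | zero => rw [show x = s from h]
  | succ i ih =>
    obtain ⟨y, hy, rfl | hyx⟩ := h
    · exact ih hy
    · exact (ih hy).tail hyx

/-- A chain growing strictly at each of these steps would exceed `N` vertices. -/
theorem exists_within_succ_subset : ∃ i ≤ N, Within E s (i + 1) ⊆ Within E s i := by
  classical
  by_contra! h
  have : ∀ i ≤ N + 1, i < (Finset.univ.filter (· ∈ Within E s i)).card := by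
    intro i hi
    induction i with
    | zero => exact Finset.card_pos.2 ⟨s, by simp [Within]⟩
    | succ i ih =>
      refine (Nat.succ_le_of_lt (ih (by omega))).trans_lt (Finset.card_lt_card ?_)
      refine Finset.ssubset_iff_subset_ne.2 ⟨fun x hx => ?_, fun e => h i (by omega) fun x hx => ?_⟩
      · simpa using within_subset_succ i (by simpa using hx)
      · simpa using e.symm.subset (show x ∈ Finset.univ.filter (· ∈ Within E s (i + 1)) by simpa using hx)
  have h1 := this N (by omega)
  have h2 := this (N + 1) le_rfl
  have h3 := (Finset.card_le_univ (Finset.univ.filter (· ∈ Within E s (N + 1))))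
  rw [Fintype.card_fin] at h3
  omega

theorem within_iff_reachable {x : Fin N} :
    x ∈ Within E s (N + 1) ↔ Relation.ReflTransGen E s x := by
  refine ⟨reachable_of_within, fun h => ?_⟩
  obtain ⟨i, hi, hsub⟩ := exists_within_succ_subset (E := E) (s := s)
  have hmono : Monotone (Within E s) := monotone_nat_of_le_succ within_subset_succ
  refine hmono (show i ≤ N + 1 by omega) ?_
  induction h with
  | refl => exact hmono (Nat.zero_le i) rfl
  | tail _ hyz ih => exact hsub ⟨_, ih, .inr hyz⟩

/-- The states of the inductive counting procedure. The variables are the number `i` of steps,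
the number `c` of vertices reachable in `i` steps, the current vertex `v` and the number `d` of
vertices below `v` reachable in `i + 1` steps, and, in order to certify that `v` is not reachable
in `i + 1` steps, the current vertex `u` and the number `e` of certified vertices below `u`. A
guessed path has reached the vertex `x` in `j` steps. -/
inductive State (N : ℕ) : Type
  | loop (i c v d : ℕ)
  | yes (i c v d : ℕ) (x : Fin N) (j : ℕ)
  | no (i c v d u e : ℕ)
  | path (i c v d u e : ℕ) (x : Fin N) (j : ℕ)
  | done

/-- The steps of the inductive counting procedure. -/
def Step (E : Fin N → Fin N → Prop) (s t : Fin N) : State N → State N → Prop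
  | .loop i c v d, .yes i' c' v' d' x j =>
    v < N ∧ i' = i ∧ c' = c ∧ v' = v ∧ d' = d ∧ x = s ∧ j = 0
  | .yes i c v d x j, .yes i' c' v' d' y j' =>
    (i' = i ∧ c' = c ∧ v' = v ∧ d' = d ∧ j ≤ i ∧ j' = j + 1) ∧ (x = y ∨ E x y)
  | .yes i c v d x j, .loop i' c' v' d' =>
    i' = i ∧ c' = c ∧ v' = v + 1 ∧ d' = d + 1 ∧ x.val = v ∧ j = i + 1
  | .loop i c v d, .no i' c' v' d' u e =>
    v < N ∧ i' = i ∧ c' = c ∧ v' = v ∧ d' = d ∧ u = 0 ∧ e = 0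
  | .no i c v d u e, .no i' c' v' d' u' e' =>
    u < N ∧ i' = i ∧ c' = c ∧ v' = v ∧ d' = d ∧ u' = u + 1 ∧ e' = e
  | .no i c v d u e, .path i' c' v' d' u' e' x j =>
    u < N ∧ i' = i ∧ c' = c ∧ v' = v ∧ d' = d ∧ u' = u ∧ e' = e ∧ x = s ∧ j = 0
  | .path i c v d u e x j, .path i' c' v' d' u' e' y j' =>
    (i' = i ∧ c' = c ∧ v' = v ∧ d' = d ∧ u' = u ∧ e' = e ∧ j < i ∧ j' = j + 1) ∧ (x = y ∨ E x y)
  | .path i c v d u e x j, .no i' c' v' d' u' e' =>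
    (i' = i ∧ c' = c ∧ v' = v ∧ d' = d ∧ u' = u + 1 ∧ e' = e + 1 ∧ x.val = u ∧ j = i ∧
      x.val ≠ v) ∧ ¬ ∃ h : v < N, E x ⟨v, h⟩
  | .no i c v d u e, .loop i' c' v' d' =>
    u = N ∧ e = c ∧ i' = i ∧ c' = c ∧ v' = v + 1 ∧ d' = d
  | .loop i _ v d, .loop i' c' v' d' =>
    v = N ∧ i < N ∧ i' = i + 1 ∧ c' = d ∧ v' = 0 ∧ d' = 0
  | .no i c v _ u e, .done => i = N ∧ v = t.val ∧ u = N ∧ e = c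
  | _, _ => False

/-- The invariant of the inductive counting procedure. -/
def Inv (E : Fin N → Fin N → Prop) (s t : Fin N) : State N → Prop
  | .loop i c v d => i ≤ N ∧ c = cnt E s i N ∧ v ≤ N ∧ d = cnt E s (i + 1) v
  | .yes i c v d x j => i ≤ N ∧ c = cnt E s i N ∧ v < N ∧ d = cnt E s (i + 1) v ∧
      x ∈ Within E s j ∧ j ≤ i + 1
  | .no i c v d u e => i ≤ N ∧ c = cnt E s i N ∧ d = cnt E s (i + 1) v ∧
      u ≤ N ∧ ∃ h : v < N, e ≤ cntAvoid E s i u ⟨v, h⟩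
  | .path i c v d u e x j => i ≤ N ∧ c = cnt E s i N ∧ d = cnt E s (i + 1) v ∧
      u < N ∧ (∃ h : v < N, e ≤ cntAvoid E s i u ⟨v, h⟩) ∧ x ∈ Within E s j ∧ j ≤ i
  | .done => t ∉ Within E s (N + 1)

variable {t : Fin N}

/-- Soundness. Skipping a vertex can only make `e` too small, so `e = c` is conclusive, while `d`
stays exact because `v` advances only once its status is certified. -/
theorem Inv.step {a b : State N} (ha : Inv E s t a) (hab : Step E s t a b) : Inv E s t b := by
  rcases a with ⟨i, c, v, d⟩ | ⟨i, c, v, d, x, j⟩ | ⟨i, c, v, d, u, e⟩ |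
      ⟨i, c, v, d, u, e, x, j⟩ | _ <;>
    rcases b with ⟨i', c', v', d'⟩ | ⟨i', c', v', d', y, j'⟩ | ⟨i', c', v', d', u', e'⟩ |
      ⟨i', c', v', d', u', e', y, j'⟩ | _ <;>
    simp only [Step] at hab <;> simp only [Inv] at ha
  · obtain ⟨rfl, h, rfl, rfl, rfl, rfl⟩ := hab
    exact ⟨h, ha.2.2.2, Nat.zero_le _, (cnt_zero _).symm⟩
  · obtain ⟨h, rfl, rfl, rfl, rfl, rfl, rfl⟩ := hab
    exact ⟨ha.1, ha.2.1, h, ha.2.2.2, rfl, Nat.zero_le _⟩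
  · obtain ⟨h, rfl, rfl, rfl, rfl, rfl, rfl⟩ := hab
    exact ⟨ha.1, ha.2.1, ha.2.2.2, Nat.zero_le _, h, Nat.zero_le _⟩
  · obtain ⟨rfl, rfl, rfl, rfl, rfl, rfl⟩ := hab
    obtain ⟨h1, h2, h3, h4, h5, h6⟩ := ha
    exact ⟨h1, h2, h3, by rw [cnt_succ_of_mem h5, h4]⟩
  · obtain ⟨⟨rfl, rfl, rfl, rfl, h, rfl⟩, h'⟩ := hab
    obtain ⟨h1, h2, h3, h4, h5, h6⟩ := ha
    exact ⟨h1, h2, h3, h4, ⟨x, h5, h'⟩, by omega⟩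
  · obtain ⟨rfl, rfl, rfl, rfl, rfl, rfl⟩ := hab
    obtain ⟨h1, h2, h3, h4, h5, h6⟩ := ha
    refine ⟨h1, h2, h5, ?_⟩
    rw [h3]
    exact (cnt_succ_of_notMem (v := ⟨v, h5⟩) (notMem_of_cnt_le (h2 ▸ h6))).symm
  · obtain ⟨h, rfl, rfl, rfl, rfl, rfl, rfl⟩ := hab
    obtain ⟨h1, h2, h3, h4, h5, h6⟩ := ha
    exact ⟨h1, h2, h3, h, h5, h6.trans (cntAvoid_le_succ _ ⟨u, h⟩ _)⟩
  · obtain ⟨h, rfl, rfl, rfl, rfl, rfl, rfl, rfl, rfl⟩ := hab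
    obtain ⟨h1, h2, h3, h4, h5⟩ := ha
    exact ⟨h1, h2, h3, h, h5, rfl, Nat.zero_le _⟩
  · obtain ⟨rfl, rfl, rfl, rfl⟩ := hab
    obtain ⟨h1, h2, h3, h4, h5, h6⟩ := ha
    exact notMem_of_cnt_le (h2 ▸ h6)
  · obtain ⟨⟨rfl, rfl, rfl, rfl, rfl, rfl, rfl, rfl, h⟩, h'⟩ := hab
    obtain ⟨h1, h2, h3, h4, ⟨h5, h6⟩, h7, h8⟩ := ha
    refine ⟨h1, h2, h3, h4, h5, ?_⟩
    rw [cntAvoid_succ_of_mem h7 (fun e => h (Fin.ext_iff.1 e)) fun e => h' ⟨h5, e⟩]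
    omega
  · obtain ⟨⟨rfl, rfl, rfl, rfl, rfl, rfl, h, rfl⟩, h'⟩ := hab
    obtain ⟨h1, h2, h3, h4, h5, h6, h7⟩ := ha
    exact ⟨h1, h2, h3, h4, h5, ⟨x, h6, h'⟩, by omega⟩

/-- The initial state. -/
def State.initial (N : ℕ) : State N := .loop 0 1 0 0

theorem inv_of_reachable {a : State N}
    (h : Relation.ReflTransGen (Step E s t) (.initial N) a) : Inv E s t a := by
  induction h with
  | refl => exact ⟨Nat.zero_le _, cnt_zero_right.symm, Nat.zero_le _, (cnt_zero _).symm⟩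
  | tail _ hab ih => exact ih.step hab

/-! ### Completeness of the counting procedure -/

theorem reach_yes (i c v d : ℕ) (hv : v < N) {j : ℕ} (hj : j ≤ i + 1) {x : Fin N}
    (hx : x ∈ Within E s j) :
    Relation.ReflTransGen (Step E s t) (.loop i c v d) (.yes i c v d x j) := by
  induction j generalizing x with
  | zero =>
    obtain rfl : x = s := hx
    exact .single (by simpa [Step] using hv)
  | succ j ih =>
    obtain ⟨y, hy, hyx⟩ := hx
    exact (ih (by omega) hy).tail ⟨⟨rfl, rfl, rfl, rfl, by omega, rfl⟩, hyx⟩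

theorem reach_path (i c v d u e : ℕ) (hu : u < N) {j : ℕ} (hj : j ≤ i) {x : Fin N}
    (hx : x ∈ Within E s j) :
    Relation.ReflTransGen (Step E s t) (.no i c v d u e) (.path i c v d u e x j) := by
  induction j generalizing x with
  | zero =>
    obtain rfl : x = s := hx
    exact .single (by simpa [Step] using hu)
  | succ j ih =>
    obtain ⟨y, hy, hyx⟩ := hx
    exact (ih (by omega) hy).tail ⟨⟨rfl, rfl, rfl, rfl, rfl, rfl, by omega, rfl⟩, hyx⟩

/-- The run with correct guesses: certify each `u` within `i` steps by a path, skip every other one.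
-/
theorem reach_no (i c d : ℕ) {v : Fin N} (hv : v ∉ Within E s (i + 1)) {u : ℕ} (hu : u ≤ N) :
    Relation.ReflTransGen (Step E s t) (.loop i c v d)
      (.no i c v d u (cntAvoid E s i u v)) := by
  induction u with
  | zero =>
    rw [cntAvoid_zero]
    exact .single ⟨v.2, rfl, rfl, rfl, rfl, rfl, rfl⟩
  | succ u ih =>
    refine (ih (by omega)).trans ?_
    by_cases h : (⟨u, hu⟩ : Fin N) ∈ Within E s i
    · have h1 : (⟨u, hu⟩ : Fin N) ≠ v := fun e => hv ⟨_, h, .inl e⟩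
      have h2 : ¬ E ⟨u, hu⟩ v := fun e => hv ⟨_, h, .inr e⟩
      rw [cntAvoid_succ_of_mem h h1 h2]
      exact (reach_path i c v d u _ hu le_rfl h).tail
        ⟨⟨rfl, rfl, rfl, rfl, rfl, rfl, rfl, rfl, fun e => h1 (Fin.ext e)⟩, fun ⟨_, e⟩ => h2 e⟩
    · rw [cntAvoid_succ_of_notMem (u := ⟨u, hu⟩) h]
      exact .single ⟨hu, rfl, rfl, rfl, rfl, rfl, rfl⟩

theorem reach_loop_vertex (i : ℕ) {v : ℕ} (hv : v ≤ N) :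
    Relation.ReflTransGen (Step E s t) (.loop i (cnt E s i N) 0 0)
      (.loop i (cnt E s i N) v (cnt E s (i + 1) v)) := by
  induction v with
  | zero => rw [cnt_zero]
  | succ v ih =>
    refine (ih (by omega)).trans ?_
    by_cases h : (⟨v, hv⟩ : Fin N) ∈ Within E s (i + 1)
    · rw [cnt_succ_of_mem h]
      exact (reach_yes i _ v _ hv le_rfl h).tail ⟨rfl, rfl, rfl, rfl, rfl, rfl⟩
    · rw [cnt_succ_of_notMem (v := ⟨v, hv⟩) h]
      exact (reach_no i _ _ h le_rfl).tail ⟨rfl, cntAvoid_eq_of_notMem h, rfl, rfl, rfl, rfl⟩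

theorem reach_loop {i : ℕ} (hi : i ≤ N) :
    Relation.ReflTransGen (Step E s t) (.initial N) (.loop i (cnt E s i N) 0 0) := by
  induction i with
  | zero => rw [cnt_zero_right, State.initial]
  | succ i ih =>
    exact ((ih (by omega)).trans (reach_loop_vertex i le_rfl)).tail
      ⟨rfl, hi, rfl, rfl, rfl, rfl⟩

theorem reach_done_iff : Relation.ReflTransGen (Step E s t) (.initial N) .done ↔
    ¬ Relation.ReflTransGen E s t := by
  rw [← within_iff_reachable]
  refine ⟨fun h => inv_of_reachable h, fun h => ?_⟩
  exact (((reach_loop le_rfl).trans (reach_loop_vertex N t.2.le)).trans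
    (reach_no N _ _ h le_rfl)).tail ⟨rfl, rfl, rfl, cntAvoid_eq_of_notMem h⟩

/-- An injective numerical code of the states. -/
def State.code : State N → Fin 9 → ℕ
  | .loop i c v d => ![0, i, c, v, d, 0, 0, 0, 0]
  | .yes i c v d x j => ![1, i, c, v, d, 0, 0, x, j]
  | .no i c v d u e => ![2, i, c, v, d, u, e, 0, 0]
  | .path i c v d u e x j => ![3, i, c, v, d, u, e, x, j]
  | .done => ![4, 0, 0, 0, 0, 0, 0, 0, 0]

theorem State.code_injective : Function.Injective (State.code (N := N)) := by
  intro a b h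
  have hc := congrFun h
  rcases a with ⟨i, c, v, d⟩ | ⟨i, c, v, d, x, j⟩ | ⟨i, c, v, d, u, e⟩ |
      ⟨i, c, v, d, u, e, x, j⟩ | _ <;>
    rcases b with ⟨i', c', v', d'⟩ | ⟨i', c', v', d', y, j'⟩ | ⟨i', c', v', d', u', e'⟩ |
      ⟨i', c', v', d', u', e', y, j'⟩ | _ <;>
    first
    | (have h0 := hc 0
       simp [State.code] at h0
       done)
    | (have h1 := hc 1; have h2 := hc 2; have h3 := hc 3; have h4 := hc 4; have h5 := hc 5
       have h6 := hc 6; have h7 := hc 7; have h8 := hc 8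
       simp [State.code, ← Fin.ext_iff] at h1 h2 h3 h4 h5 h6 h7 h8
       simp [*])

/-- The states whose code is bounded by `N + 4`. -/
def BoundedState (N : ℕ) : Type := {a : State N // ∀ k, a.code k < N + 5}

/-- `Inv` depends on the edges, hence on the input, and cannot cut out the vertex set of a graph
that must be fixed for each input length; this bound can. The tag is at most `4` and every other
entry at most `N + 1`. -/
theorem Inv.bounded {a : State N} (h : Inv E s t a) : ∀ k, a.code k < N + 5 := by
  have hc := cnt_le (E := E) (s := s)
  have ha := cntAvoid_le (E := E) (s := s)
  rcases a with ⟨i, c, v, d⟩ | ⟨i, c, v, d, x, j⟩ | ⟨i, c, v, d, u, e⟩ |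
      ⟨i, c, v, d, u, e, x, j⟩ | _
  · obtain ⟨h1, rfl, h3, rfl⟩ := h
    have := hc i N
    have := hc (i + 1) v
    intro k
    fin_cases k <;> simp [State.code] <;> omega
  · obtain ⟨h1, rfl, h3, rfl, _, h5⟩ := h
    have := hc i N
    have := hc (i + 1) v
    have := x.2
    intro k
    fin_cases k <;> simp [State.code] <;> omega
  · obtain ⟨h1, rfl, rfl, h3, h4, h5⟩ := h
    have := hc i N
    have := hc (i + 1) v
    have := ha i u ⟨v, h4⟩
    intro k
    fin_cases k <;> simp [State.code] <;> omega
  · obtain ⟨h1, rfl, rfl, h3, ⟨h4, h5⟩, _, h6⟩ := h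
    have := hc i N
    have := hc (i + 1) v
    have := ha i u ⟨v, h4⟩
    have := x.2
    intro k
    fin_cases k <;> simp [State.code] <;> omega
  · intro k
    fin_cases k <;> simp [State.code]

/-- The code of a bounded state as a tuple of elements of a finite type. -/
def BoundedState.code (a : BoundedState N) : Fin 9 → Fin (N + 5) :=
  fun k => ⟨a.1.code k, a.2 k⟩

theorem BoundedState.code_injective : Function.Injective (BoundedState.code (N := N)) :=
  fun _ _ h => Subtype.ext (State.code_injective
    (funext fun k => congrArg Fin.val (congrFun h k)))

instance : Finite (BoundedState N) := Finite.of_injective _ BoundedState.code_injective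

theorem BoundedState.card_le : Nat.card (BoundedState N) ≤ (N + 5) ^ 9 := by
  simpa using Nat.card_le_card_of_injective _ (BoundedState.code_injective (N := N))

end InductiveCounting

/-- Reachability in a relation agrees with reachability in its restriction to a set that contains
everything reachable. -/
theorem reflTransGen_subtype_iff {α : Type} {r : α → α → Prop} {p : α → Prop} {a : α}
    (hp : ∀ b, Relation.ReflTransGen r a b → p b) (ha : p a) {b : α} (hb : p b) :
    Relation.ReflTransGen (fun x y : {x // p x} => r x.1 y.1) ⟨a, ha⟩ ⟨b, hb⟩ ↔
      Relation.ReflTransGen r a b := by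
  refine ⟨fun h => h.lift Subtype.val fun _ _ h => h, fun h => ?_⟩
  induction h with
  | refl => exact .refl
  | tail h1 h2 ih => exact (ih (hp _ h1)).tail h2

/-! ## Literals and polynomial bounds -/

/-- A constant or a possibly negated input variable. -/
inductive Literal (n : ℕ) : Type
  | const (b : Bool)
  | var (i : Fin n) (b : Bool)

/-- The value of a literal. -/
def Literal.eval {n : ℕ} (x : Fin n → Bool) : Literal n → Bool
  | .const b => b
  | .var i b => x i == b

/-- A property of bit strings of length `n` that is given by a literal. -/
def IsLiteral {n : ℕ} (φ : (Fin n → Bool) → Prop) : Prop :=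
  ∃ l : Literal n, ∀ x, φ x ↔ l.eval x = true

namespace IsLiteral

variable {n : ℕ} {φ : (Fin n → Bool) → Prop}

theorem of_const {P : Prop} (h : ∀ x, φ x ↔ P) : IsLiteral φ := by
  classical
  exact ⟨.const (decide P), fun x => by simp [Literal.eval, h]⟩

theorem const (P : Prop) : IsLiteral fun _ : Fin n → Bool => P := of_const fun _ => Iff.rfl

/-- A Boolean function of one bit is constant, the bit or its negation; the two constant strings
tell which. -/
theorem of_coord (i : Fin n) (h : ∀ x y, x i = y i → (φ x ↔ φ y)) : IsLiteral φ := by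
  by_cases ht : φ fun _ => true <;> by_cases hf : φ fun _ => false
  · refine of_const (P := True) fun x => ?_
    cases hx : x i
    · simpa [hf] using h x (fun _ => false) hx
    · simpa [ht] using h x (fun _ => true) hx
  · refine ⟨.var i true, fun x => ?_⟩
    cases hx : x i
    · simpa [hf, Literal.eval, hx] using h x (fun _ => false) hx
    · simpa [ht, Literal.eval, hx] using h x (fun _ => true) hx
  · refine ⟨.var i false, fun x => ?_⟩
    cases hx : x i
    · simpa [hf, Literal.eval, hx] using h x (fun _ => false) hx
    · simpa [ht, Literal.eval, hx] using h x (fun _ => true) hx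
  · refine of_const (P := False) fun x => ?_
    cases hx : x i
    · simpa [hf] using h x (fun _ => false) hx
    · simpa [ht] using h x (fun _ => true) hx

theorem const_and (P : Prop) (h : IsLiteral φ) : IsLiteral fun x => P ∧ φ x := by
  by_cases hP : P
  · simpa [hP] using h
  · simpa [hP] using const False

theorem const_or (P : Prop) (h : IsLiteral φ) : IsLiteral fun x => P ∨ φ x := by
  by_cases hP : P
  · simpa [hP] using const True
  · simpa [hP] using h

theorem not (h : IsLiteral φ) : IsLiteral fun x => ¬ φ x := by
  obtain ⟨l, hl⟩ := h
  cases l with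
  | const b => exact ⟨.const !b, fun x => by simp [hl, Literal.eval]⟩
  | var i b => exact ⟨.var i !b, fun x => by simp [hl, Literal.eval, Bool.eq_not]⟩

end IsLiteral

/-- Between two fixed states, a step consults at most one edge, and all its other conditions are
independent of the input. -/
theorem InductiveCounting.isLiteral_step {n N : ℕ} {E : (Fin n → Bool) → Fin N → Fin N → Prop}
    (hE : ∀ a b, IsLiteral fun x => E x a b) (s t : Fin N) (a b : State N) :
    IsLiteral fun x => Step (E x) s t a b := by
  rcases a with ⟨i, c, v, d⟩ | ⟨i, c, v, d, x, j⟩ | ⟨i, c, v, d, u, e⟩ |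
      ⟨i, c, v, d, u, e, x, j⟩ | _ <;>
    rcases b with ⟨i', c', v', d'⟩ | ⟨i', c', v', d', y, j'⟩ | ⟨i', c', v', d', u', e'⟩ |
      ⟨i', c', v', d', u', e', y, j'⟩ | _ <;>
    first
    | exact .const _
    | exact .const_and _ (.const_or _ (hE _ _))
    | (refine .const_and _ (.not ?_)
       by_cases hv : v < N
       · simpa [hv] using hE x ⟨v, hv⟩
       · simpa [hv] using .const False)

/-- The function `g` is bounded by a polynomial. -/
def PolyBounded (g : ℕ → ℕ) : Prop := ∃ p : Polynomial ℕ, ∀ n, g n ≤ p.eval n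

namespace PolyBounded

variable {f g : ℕ → ℕ}

theorem mono (hg : PolyBounded g) (h : ∀ n, f n ≤ g n) : PolyBounded f := by
  obtain ⟨p, hp⟩ := hg
  exact ⟨p, fun n => (h n).trans (hp n)⟩

theorem const (c : ℕ) : PolyBounded fun _ => c := ⟨.C c, fun n => by simp⟩

theorem id : PolyBounded fun n => n := ⟨.X, fun n => by simp⟩

theorem add (hf : PolyBounded f) (hg : PolyBounded g) : PolyBounded fun n => f n + g n := by
  obtain ⟨p, hp⟩ := hf
  obtain ⟨q, hq⟩ := hg
  exact ⟨p + q, fun n => by simpa using add_le_add (hp n) (hq n)⟩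

theorem mul (hf : PolyBounded f) (hg : PolyBounded g) : PolyBounded fun n => f n * g n := by
  obtain ⟨p, hp⟩ := hf
  obtain ⟨q, hq⟩ := hg
  exact ⟨p * q, fun n => by simpa using Nat.mul_le_mul (hp n) (hq n)⟩

theorem pow (hf : PolyBounded f) (k : ℕ) : PolyBounded fun n => f n ^ k := by
  obtain ⟨p, hp⟩ := hf
  exact ⟨p ^ k, fun n => by simpa using Nat.pow_le_pow_left (hp n) k⟩

theorem log : PolyBounded fun n => Nat.log 2 n := id.mono fun n => Nat.log_le_self 2 n

/-- This bounds the number of tape contents in logarithmic space. Replacing `a` by `2 ^ a` leaves a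
fixed power of `2 ^ Nat.log 2 n * 2`. -/
theorem pow_log (a k : ℕ) : PolyBounded fun n => a ^ (k * (Nat.log 2 n + 1)) := by
  refine (((id.add (const 1)).mul (const 2)).pow (a * k)).mono fun n => ?_
  have h1 : 2 ^ Nat.log 2 n ≤ n + 1 := by
    rcases Nat.eq_zero_or_pos n with rfl | hn
    · simp
    · exact (Nat.pow_log_le_self 2 hn.ne').trans (Nat.le_succ n)
  calc a ^ (k * (Nat.log 2 n + 1)) ≤ (2 ^ a) ^ (k * (Nat.log 2 n + 1)) :=
        Nat.pow_le_pow_left Nat.lt_two_pow_self.le _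
    _ = (2 ^ Nat.log 2 n * 2) ^ (a * k) := by
        rw [← pow_succ, ← pow_mul, ← pow_mul]
        congr 1
        ring
    _ ≤ ((n + 1) * 2) ^ (a * k) := Nat.pow_le_pow_left (Nat.mul_le_mul_right 2 h1) _

end PolyBounded

/-! ## Configuration graphs -/

/-- Reachability is invariant under isomorphism. -/
theorem reflTransGen_equiv_iff {α β : Type} (e : α ≃ β) (r : α → α → Prop) (a b : α) :
    Relation.ReflTransGen (fun x y => r (e.symm x) (e.symm y)) (e a) (e b) ↔
      Relation.ReflTransGen r a b := by
  refine ⟨fun h => ?_, fun h => h.lift e (fun x y hxy => by simpa [Function.onFun] using hxy) _ _⟩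
  simpa [Function.onFun] using Relation.ReflTransGen.lift (p := r) e.symm (fun x y hxy => hxy) _ _ h

namespace NTM

variable (M : NTM)

/-- The configurations which use at most `B` cells of the work tape and whose input head is on a
word of length `n` or one of its end markers. -/
def BoundedCfg (n B : ℕ) : Type :=
  {c : M.Cfg // c.inputHead < n + 2 ∧ c.workHead < B ∧ ∀ j, B ≤ j → c.tape j = M.blank}

/-- The components of a bounded configuration. -/
def BoundedCfg.code {M : NTM} {n B : ℕ} (c : M.BoundedCfg n B) :
    M.State × Fin (n + 2) × (Fin B → M.Work) × Fin B :=
  (c.1.state, ⟨c.1.inputHead, c.2.1⟩, fun j => c.1.tape j, ⟨c.1.workHead, c.2.2.1⟩)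

theorem BoundedCfg.code_injective {M : NTM} {n B : ℕ} :
    Function.Injective (BoundedCfg.code (M := M) (n := n) (B := B)) := by
  rintro ⟨⟨q, p, τ, h⟩, hc⟩ ⟨⟨q', p', τ', h'⟩, hc'⟩ e
  simp only [BoundedCfg.code, Prod.mk.injEq, Fin.mk.injEq] at e hc hc'
  obtain ⟨rfl, rfl, h3, rfl⟩ := e
  have : τ = τ' := by
    funext j
    by_cases hj : j < B
    · exact congrFun h3 ⟨j, hj⟩
    · rw [hc.2.2 j (by omega), hc'.2.2 j (by omega)]
  subst this
  rfl

instance (n B : ℕ) : Finite (M.BoundedCfg n B) :=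
  have := M.finite_state
  have := M.finite_work
  Finite.of_injective _ BoundedCfg.code_injective

theorem card_boundedCfg_le (n B : ℕ) : Nat.card (M.BoundedCfg n B) ≤
    Nat.card M.State * ((n + 2) * (Nat.card M.Work ^ B * B)) := by
  have := M.finite_state
  have := M.finite_work
  simpa [Nat.card_prod, Nat.card_fun] using
    Nat.card_le_card_of_injective _ (BoundedCfg.code_injective (M := M) (n := n) (B := B))

theorem Reaches.bounded {M : NTM} {w : List Bool} {B : ℕ}
    (hB : ∀ c, M.Reaches w c → c.workHead < B) {c : M.Cfg} (h : M.Reaches w c) :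
    c.inputHead < w.length + 2 ∧ c.workHead < B ∧ ∀ j, B ≤ j → c.tape j = M.blank := by
  refine ⟨?_, hB c h, ?_⟩
  · rcases h.cases_tail with h | ⟨_, _, q, a, mi, mw, _, rfl⟩
    · rw [h]
      exact Nat.succ_pos _
    · change min _ (w.length + 1) < _
      omega
  · intro j hj
    induction h with
    | refl => rfl
    | @tail b c hb hbc ih =>
      obtain ⟨q, a, mi, mw, _, rfl⟩ := hbc
      have := hB b hb
      exact (Function.update_of_ne (by omega) _ _).trans ih

/-- For fixed configurations only the bit under the input head matters; off the word the symbol is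
an end marker, the same for all words of length `n`. -/
theorem isLiteral_step {M : NTM} {n : ℕ} (c c' : M.Cfg) :
    IsLiteral fun x : Fin n → Bool => M.Step (List.ofFn x) c c' := by
  by_cases h : ∃ i : Fin n, c.inputHead = i + 1
  · obtain ⟨i, hi⟩ := h
    refine .of_coord i fun x y hxy => ?_
    simp [Step, hi, inputSymbolAt, hxy]
  · refine .of_const (P := M.Step (List.replicate n false) c c') fun x => ?_
    have : inputSymbolAt (List.ofFn x) c.inputHead =
        inputSymbolAt (List.replicate n false) c.inputHead := by
      rcases hp : c.inputHead with _ | p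
      · rfl
      · have hpn : n ≤ p := by
          by_contra hlt
          exact h ⟨⟨p, by omega⟩, hp⟩
        simp [inputSymbolAt, hpn]
    simp [Step, this]

/-- The configuration graph, with an additional vertex `none` for acceptance. -/
def graph (n B : ℕ) (w : List Bool) :
    Option (M.BoundedCfg n B) → Option (M.BoundedCfg n B) → Prop
  | some c, some c' => M.Step w c.1 c'.1
  | some c, none => c.1.state ∈ M.accept
  | none, _ => False

theorem isLiteral_graph {M : NTM} {n B : ℕ} (a b : Option (M.BoundedCfg n B)) :
    IsLiteral fun x : Fin n → Bool => M.graph n B (List.ofFn x) a b := by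
  rcases a with _ | c <;> rcases b with _ | c'
  · exact .const False
  · exact .const False
  · exact .const (c.1.state ∈ M.accept)
  · exact isLiteral_step _ _

end NTM

/-- The words of length `n` of a language in `NL` are described by reachability in a graph of
polynomial size, each of whose edges is given by a literal. -/
theorem IsNL.exists_graph {L : Set (List Bool)} (hL : IsNL L) :
    ∃ g : ℕ → ℕ, PolyBounded g ∧ ∀ n, ∃ (N : ℕ) (E : (Fin n → Bool) → Fin N → Fin N → Prop)
      (s t : Fin N), N ≤ g n ∧ (∀ a b, IsLiteral fun x => E x a b) ∧
        ∀ x, List.ofFn x ∈ L ↔ Relation.ReflTransGen (E x) s t := by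
  obtain ⟨M, ⟨k, hk⟩, hM⟩ := hL
  let B : ℕ → ℕ := fun n => k * (Nat.log 2 n + 1)
  have hB : PolyBounded B := (PolyBounded.const k).mul (PolyBounded.log.add (.const 1))
  refine ⟨fun n => Nat.card M.State * ((n + 2) * (Nat.card M.Work ^ B n * B n)) + 1,
    ((PolyBounded.const _).mul ((PolyBounded.id.add (.const 2)).mul
      ((PolyBounded.pow_log _ k).mul hB))).add (.const 1), fun n => ?_⟩
  have hbd : ∀ (x : Fin n → Bool) (c : M.Cfg), M.Reaches (List.ofFn x) c →
      c.inputHead < n + 2 ∧ c.workHead < B n ∧ ∀ j, B n ≤ j → c.tape j = M.blank := by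
    intro x c h
    simpa using h.bounded (B := B n) (by simpa [B] using hk (List.ofFn x))
  -- The initial configuration is common to all inputs, so any word of length `n` serves here.
  have h0 := hbd (fun _ => false) M.init .refl
  let e := Finite.equivFin (Option (M.BoundedCfg n (B n)))
  refine ⟨_, fun x a b => M.graph n (B n) (List.ofFn x) (e.symm a) (e.symm b),
    e (some ⟨M.init, h0⟩), e none, ?_, fun a b => ?_, fun x => ?_⟩
  · rw [Finite.card_option]
    exact Nat.succ_le_succ (M.card_boundedCfg_le n (B n))
  · exact NTM.isLiteral_graph _ _
  · rw [hM, reflTransGen_equiv_iff e (M.graph n (B n) (List.ofFn x))]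
    constructor
    · rintro ⟨c, hc, hacc⟩
      have := (reflTransGen_subtype_iff (hbd x) h0 (hbd x c hc)).2 hc
      refine .tail (b := some ⟨c, hbd x c hc⟩) ?_
        (show M.graph n (B n) (List.ofFn x) (some ⟨c, hbd x c hc⟩) none from hacc)
      exact Relation.ReflTransGen.lift (p := M.graph n (B n) (List.ofFn x)) some
        (fun _ _ h => h) _ _ this
    · intro h
      obtain h | ⟨b, hb, hacc⟩ := h.cases_tail
      · cases h
      -- The vertex `none` has no outgoing edges, so a path ending in a configuration is a genuine
      -- computation.
      · have key : ∀ b, Relation.ReflTransGen (M.graph n (B n) (List.ofFn x))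
            (some ⟨M.init, h0⟩) b → ∀ c, b = some c → M.Reaches (List.ofFn x) c.1 := by
          intro b hb
          induction hb with
          | refl =>
            rintro c ⟨⟩
            exact .refl
          | @tail b b' _ hbb' ih =>
            rintro c rfl
            rcases b with _ | b
            · exact hbb'.elim
            · exact (ih b rfl).tail hbb'
        rcases b with _ | b
        · exact hacc.elim
        · exact ⟨b.1, key _ hb b rfl, hacc⟩

/-- The Immerman–Szelepcsényi theorem for graphs described by literals. -/
theorem IsNL.exists_graph_compl {L : Set (List Bool)} (hL : IsNL L) :
    ∃ g : ℕ → ℕ, PolyBounded g ∧ ∀ n, ∃ (Q : Type) (_ : Finite Q)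
      (E : (Fin n → Bool) → Q → Q → Prop) (s t : Q), Nat.card Q ≤ g n ∧
        (∀ a b, IsLiteral fun x => E x a b) ∧
        ∀ x, List.ofFn x ∈ L ↔ ¬ Relation.ReflTransGen (E x) s t := by
  obtain ⟨g, hg, h⟩ := hL.exists_graph
  refine ⟨fun n => (g n + 5) ^ 9, (hg.add (.const 5)).pow 9, fun n => ?_⟩
  obtain ⟨N, E, s, t, hN, hE, hr⟩ := h n
  have hi := InductiveCounting.Inv.bounded
    (InductiveCounting.inv_of_reachable (E := E fun _ => false) (s := s) (t := t) .refl)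
  have hd : ∀ k, (InductiveCounting.State.done : InductiveCounting.State N).code k < N + 5 := by
    intro k
    fin_cases k <;> simp [InductiveCounting.State.code]
  refine ⟨InductiveCounting.BoundedState N, inferInstance,
    fun x a b => InductiveCounting.Step (E x) s t a.1 b.1, ⟨_, hi⟩, ⟨.done, hd⟩,
    InductiveCounting.BoundedState.card_le.trans (Nat.pow_le_pow_left (by omega) 9),
    fun a b => InductiveCounting.isLiteral_step hE s t a.1 b.1, fun x => ?_⟩
  have := (reflTransGen_subtype_iff
    (fun b hb => InductiveCounting.Inv.bounded
      (InductiveCounting.inv_of_reachable (E := E x) (s := s) (t := t) hb)) hi hd).trans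
    InductiveCounting.reach_done_iff
  rw [hr, ← not_not (a := Relation.ReflTransGen (E x) s t), ← this]
  rfl

/-! ## Injectivity of the encoding -/

theorem List.replicate_true_append_false_inj {a b : ℕ} {l l' : List Bool}
    (h : List.replicate a true ++ false :: l = List.replicate b true ++ false :: l') :
    a = b ∧ l = l' := by
  induction a generalizing b with
  | zero => cases b <;> simp_all [List.replicate_succ]
  | succ a ih =>
    cases b with
    | zero => simp [List.replicate_succ] at h
    | succ b =>
      obtain ⟨rfl, h'⟩ := ih (b := b) (by simpa [List.replicate_succ] using h)
      exact ⟨rfl, h'⟩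

theorem List.eq_of_flatMap_eq {α β : Type} {f g : α → List β}
    (hl : ∀ a, (f a).length = (g a).length) {l : List α} (h : l.flatMap f = l.flatMap g) :
    ∀ a ∈ l, f a = g a := by
  induction l with
  | nil => simp
  | cons b l ih =>
    rw [List.flatMap_cons, List.flatMap_cons] at h
    obtain ⟨h1, h2⟩ := List.append_inj h (hl b)
    rintro a (_ | ⟨_, ha⟩)
    · exact h1
    · exact ih h2 a ha

theorem List.length_flatMap_of_forall {α β : Type} {f : α → List β} {k : ℕ}
    (hf : ∀ a, (f a).length = k) (l : List α) : (l.flatMap f).length = l.length * k := by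
  simp [List.length_flatMap, hf]

namespace MorphismInput

theorem length_elemCode (N : ℕ) (i : Fin N) : (elemCode N i).length = Nat.clog 2 (N + 1) := by
  simp [elemCode]

theorem elemCode_injective (N : ℕ) : Function.Injective (elemCode N) := by
  intro i j h
  have hlt : ∀ i : Fin N, i.val + 1 < 2 ^ Nat.clog 2 (N + 1) := fun i =>
    (show i.val + 1 < N + 1 by omega).trans_le (Nat.le_pow_clog (by norm_num) _)
  have h' := List.ofFn_injective h
  have : i.val + 1 = j.val + 1 := by
    refine Nat.eq_of_testBit_eq fun k => ?_
    by_cases hk : k < Nat.clog 2 (N + 1)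
    · exact congrFun h' ⟨k, hk⟩
    · have hp := Nat.pow_le_pow_right (n := 2) (by norm_num) (not_lt.1 hk)
      rw [Nat.testBit_lt_two_pow ((hlt i).trans_le hp), Nat.testBit_lt_two_pow ((hlt j).trans_le hp)]
  exact Fin.ext (by omega)

/-- The unary prefixes determine both sizes, and these fix the lengths of all later blocks. This is
needed because membership in the problem only asserts that some input has the given code. -/
theorem encode_injective : Function.Injective encode := by
  intro I J h
  obtain ⟨N, hN, mul, hmul, k, hk, letter, P⟩ := I
  obtain ⟨N', hN', mul', hmul', k', hk', letter', P'⟩ := J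
  simp only [encode, List.append_assoc, List.singleton_append] at h
  obtain ⟨rfl, h⟩ := List.replicate_true_append_false_inj h
  obtain ⟨rfl, h⟩ := List.replicate_true_append_false_inj h
  have hrow : ∀ (m : Fin N → Fin N → Fin N) (x : Fin N),
      ((List.finRange N).flatMap fun y => elemCode N (m x y)).length = N * Nat.clog 2 (N + 1) := by
    intro m x
    rw [List.length_flatMap_of_forall (fun y => length_elemCode N (m x y)), List.length_finRange]
  obtain ⟨h1, h⟩ := List.append_inj h (by
    rw [List.length_flatMap_of_forall (hrow mul), List.length_flatMap_of_forall (hrow mul')])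
  obtain ⟨h2, h3⟩ := List.append_inj h (by
    rw [List.length_flatMap_of_forall (fun a => length_elemCode N (letter a)),
      List.length_flatMap_of_forall (fun a => length_elemCode N (letter' a))])
  have e1 : mul = mul' := by
    funext x y
    have hx := List.eq_of_flatMap_eq (fun x => (hrow mul x).trans (hrow mul' x).symm) h1 x
      (List.mem_finRange x)
    exact elemCode_injective N (List.eq_of_flatMap_eq
      (fun y => (length_elemCode _ _).trans (length_elemCode _ _).symm) hx y (List.mem_finRange y))
  have e2 : letter = letter' := by
    funext a
    exact elemCode_injective N (List.eq_of_flatMap_eq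
      (fun y => (length_elemCode _ _).trans (length_elemCode _ _).symm) h2 a (List.mem_finRange a))
  have e3 : P = P' := by
    ext x
    simpa using List.map_inj_left.1 h3 x (List.mem_finRange x)
  subst e1 e2 e3
  rfl

theorem length_encode_le (I : MorphismInput) : I.encode.length ≤
    I.card + 1 + I.alph + 1 + I.card * (I.card * (I.card + 1)) + I.alph * (I.card + 1) +
      I.card := by
  have hc : Nat.clog 2 (I.card + 1) ≤ I.card + 1 :=
    Nat.clog_le_of_le_pow Nat.lt_two_pow_self.le
  have hrow : ∀ x : Fin I.card,
      ((List.finRange I.card).flatMap fun y => elemCode I.card (I.mul x y)).length =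
        I.card * Nat.clog 2 (I.card + 1) := by
    intro x
    rw [List.length_flatMap_of_forall (fun y => length_elemCode _ (I.mul x y)),
      List.length_finRange]
  simp only [encode, List.length_append, List.length_replicate, List.length_map,
    List.length_finRange, List.length_singleton, List.length_flatMap_of_forall hrow,
    List.length_flatMap_of_forall (fun a => length_elemCode _ (I.letter a))]
  gcongr

/-! ## Inputs given by abstract semigroups -/

open Classical in
/-- The input given by a finite semigroup `S`, the images of the letters from a finite alphabet
`B` and a subset `P` of `S`. -/
noncomputable def ofLetters {S B : Type} [Semigroup S] [Finite S] [Nonempty S] [Finite B]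
    [Nonempty B] (letter : B → S) (P : Set S) : MorphismInput where
  card := Nat.card S
  card_pos := Nat.card_pos
  mul x y := Finite.equivFin S ((Finite.equivFin S).symm x * (Finite.equivFin S).symm y)
  mul_assoc x y z := by simp [_root_.mul_assoc]
  alph := Nat.card B
  alph_pos := Nat.card_pos
  letter a := Finite.equivFin S (letter ((Finite.equivFin B).symm a))
  P := Finset.univ.filter fun x => (Finite.equivFin S).symm x ∈ P

variable {S B : Type} [Semigroup S] [Finite S] [Nonempty S] [Finite B] [Nonempty B]
  (letter : B → S) (P : Set S)

/-- The letters of `ofLetters letter P`. -/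
noncomputable def alphEquiv : B ≃ Fin (ofLetters letter P).alph := Finite.equivFin B

/-- The elements of the semigroup of `ofLetters letter P`. -/
noncomputable def toCarrier : S →ₙ* (ofLetters letter P).Carrier where
  toFun := Finite.equivFin S
  map_mul' x y := by
    change _ = Finite.equivFin S ((Finite.equivFin S).symm (Finite.equivFin S x) *
      (Finite.equivFin S).symm (Finite.equivFin S y))
    rw [Equiv.symm_apply_apply, Equiv.symm_apply_apply]

theorem ofLetters_hom_comp_map :
    (ofLetters letter P).hom.comp (FreeSemigroup.map (alphEquiv letter P)) =
      (toCarrier letter P).comp (FreeSemigroup.lift letter) := by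
  refine FreeSemigroup.hom_ext (funext fun b => ?_)
  exact congrArg (fun b => Finite.equivFin S (letter b)) (Equiv.symm_apply_apply _ b)

open Classical in
theorem mem_ofLetters_P (x : S) :
    (show Fin (ofLetters letter P).card from Finite.equivFin S x) ∈ (ofLetters letter P).P ↔
      x ∈ P := by
  refine Iff.trans (Finset.mem_filter (s := Finset.univ)
    (p := fun x : Fin (Nat.card S) => (Finite.equivFin S).symm x ∈ P)) ?_
  rw [Equiv.symm_apply_apply]
  exact and_iff_right (Finset.mem_univ _)

theorem map_preimage_language_ofLetters :
    FreeSemigroup.map (alphEquiv letter P) ⁻¹' (ofLetters letter P).language =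
      FreeSemigroup.lift letter ⁻¹' P := by
  ext u
  have h := DFunLike.congr_fun (ofLetters_hom_comp_map letter P) u
  change (ofLetters letter P).hom (FreeSemigroup.map (alphEquiv letter P) u) ∈
    {x : (ofLetters letter P).Carrier |
      (show Fin (ofLetters letter P).card from x) ∈ (ofLetters letter P).P} ↔ _
  rw [← MulHom.comp_apply, h]
  exact mem_ofLetters_P letter P _

/-- Renaming letters along a bijection makes each language an inverse image of the other. -/
theorem recognizes_language_ofLetters_iff (V : Pseudovariety) :
    V.Recognizes (ofLetters letter P).language ↔
      V.Recognizes (FreeSemigroup.lift letter ⁻¹' P) := by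
  rw [← map_preimage_language_ofLetters]
  refine ⟨fun h => h.preimage _, fun h => ?_⟩
  have hid : (FreeSemigroup.map (alphEquiv letter P)).comp
      (FreeSemigroup.map (alphEquiv letter P).symm) = MulHom.id _ :=
    FreeSemigroup.hom_ext (funext fun b => congrArg FreeSemigroup.of (Equiv.apply_symm_apply _ b))
  have := h.preimage (FreeSemigroup.map (alphEquiv letter P).symm)
  rwa [← Set.preimage_comp, ← MulHom.coe_comp, hid, MulHom.coe_id, Set.preimage_id] at this

end MorphismInput

theorem encode_mem_languageMembershipProblem_iff {V : Pseudovariety} (I : MorphismInput) :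
    I.encode ∈ languageMembershipProblem V ↔ V.Recognizes I.language := by
  refine ⟨?_, fun h => ⟨I, rfl, h⟩⟩
  rintro ⟨J, hJ, h⟩
  rwa [MorphismInput.encode_injective hJ] at h

/-! ## Reductions all of whose output bits are literals -/

/-- A function on bit strings of length `n` whose output bits are given by literals. -/
def IsLiteralList {n : ℕ} (F : (Fin n → Bool) → List Bool) : Prop :=
  ∃ l : List (Literal n), ∀ x, F x = l.map (Literal.eval x)

namespace IsLiteralList

variable {n : ℕ}

theorem const (l : List Bool) : IsLiteralList fun _ : Fin n → Bool => l :=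
  ⟨l.map .const, fun x => by simp [Function.comp_def, Literal.eval]⟩

theorem append {F G : (Fin n → Bool) → List Bool} (hF : IsLiteralList F) (hG : IsLiteralList G) :
    IsLiteralList fun x => F x ++ G x := by
  obtain ⟨l, hl⟩ := hF
  obtain ⟨l', hl'⟩ := hG
  exact ⟨l ++ l', fun x => by simp [hl, hl']⟩

theorem flatMap {α : Type} {F : α → (Fin n → Bool) → List Bool} (hF : ∀ a, IsLiteralList (F a))
    (l : List α) : IsLiteralList fun x => l.flatMap fun a => F a x := by
  choose L hL using hF
  exact ⟨l.flatMap L, fun x => by simp [hL, List.map_flatMap]⟩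

theorem ofFn {m : ℕ} {g : Fin m → (Fin n → Bool) → Bool}
    (hg : ∀ j, IsLiteral fun x => g j x = true) : IsLiteralList fun x => List.ofFn fun j => g j x := by
  choose L hL using hg
  refine ⟨List.ofFn L, fun x => ?_⟩
  rw [List.map_ofFn]
  exact congrArg List.ofFn (funext fun j => Bool.eq_iff_iff.2 (hL j x))

open Classical in
-- Where the codes of `u` and `v` agree the bit is constant; where they differ it is `φ` or its
-- negation.
theorem elemCode {φ : (Fin n → Bool) → Prop} (h : IsLiteral φ) {N : ℕ} (u v : Fin N) :
    IsLiteralList fun x => MorphismInput.elemCode N (if φ x then u else v) := by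
  refine ofFn (g := fun j x => Nat.testBit ((if φ x then u else v : Fin N).val + 1) j) fun j => ?_
  rcases hu : Nat.testBit (u.val + 1) j <;> rcases hv : Nat.testBit (v.val + 1) j
  · exact .of_const (P := False) fun x => by split_ifs <;> simp [*]
  · convert h.not using 2 with x
    split_ifs <;> simp [*]
  · convert h using 2 with x
    split_ifs <;> simp [*]
  · exact .of_const (P := True) fun x => by split_ifs <;> simp [*]

theorem encode {N : ℕ} (hN : 0 < N) (mul : Fin N → Fin N → Fin N)
    (hmul : ∀ x y z, mul (mul x y) z = mul x (mul y z)) {k : ℕ} (hk : 0 < k)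
    {letter : (Fin n → Bool) → Fin k → Fin N} (P : Finset (Fin N))
    (h : ∀ a, IsLiteralList fun x => MorphismInput.elemCode N (letter x a)) :
    IsLiteralList fun x =>
      (MorphismInput.mk N hN mul hmul k hk (letter x) P).encode := by
  simp only [MorphismInput.encode]
  exact .append (.append (const _) (flatMap h _))
    (const ((List.finRange N).map fun i => decide (i ∈ P)))

open Classical in
theorem encode_ofLetters {S B : Type} [Semigroup S] [Finite S] [Nonempty S] [Finite B] [Nonempty B]
    {letter : (Fin n → Bool) → B → S} (P : Set S)
    (h : ∀ b, ∃ φ : (Fin n → Bool) → Prop, IsLiteral φ ∧ ∃ u v, ∀ x,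
      letter x b = if φ x then u else v) :
    IsLiteralList fun x => (MorphismInput.ofLetters (letter x) P).encode := by
  refine encode _ _ _ _ _ fun a => ?_
  obtain ⟨φ, hφ, u, v, huv⟩ := h ((Finite.equivFin B).symm a)
  convert elemCode hφ (Finite.equivFin S u) (Finite.equivFin S v) using 3 with x
  rw [huv]
  split_ifs <;> rfl

end IsLiteralList

/-- An empty conjunction is true; such a gate, with a sign on the output, supplies both constants.
-/
theorem BoolCircuit.gateVal_of_no_wires {n m : ℕ} (C : BoolCircuit n m) (x : Fin n → Bool)
    (g : C.Gate) (h : C.isAnd g = true) (hi : C.inputWires g = ∅) (hg : C.gateWires g = ∅) :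
    C.gateVal x g = true := by
  rw [BoolCircuit.gateVal, if_pos h]
  simp [hi, hg]

/-- The circuit without wires whose outputs are given by literals. -/
def Literal.circuit {n : ℕ} (l : List (Literal n)) : BoolCircuit n l.length where
  Gate := Unit
  fintypeGate := inferInstance
  isAnd _ := true
  inputWires _ := ∅
  gateWires _ := ∅
  level _ := 0
  level_lt h := h.elim
  output j := match l.get j with
    | .const b => (.inr (), b)
    | .var i b => (.inl i, b)

theorem Literal.circuit_eval {n : ℕ} (l : List (Literal n)) (x : Fin n → Bool) :
    List.ofFn ((Literal.circuit l).eval x) = l.map (Literal.eval x) := by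
  have hg : (Literal.circuit l).gateVal x () = true :=
    (Literal.circuit l).gateVal_of_no_wires x _ rfl rfl rfl
  conv_rhs => rw [← List.ofFn_get l, List.map_ofFn]
  congr 1
  funext j
  rw [BoolCircuit.eval, Function.comp_apply]
  have ho : (Literal.circuit l).output j = match l.get j with
    | .const b => (.inr (), b)
    | .var i b => (.inl i, b) := rfl
  rw [ho]
  rcases l.get j with b | ⟨i, b⟩
  · change ((Literal.circuit l).gateVal x () == b) = b
    simp [hg]
  · simp [Literal.eval]

/-- A reduction whose output bits are literals is an `AC⁰` reduction. -/
theorem AC0Reducible.of_literals {L L' : Set (List Bool)} {g : ℕ → ℕ} (hg : PolyBounded g)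
    (h : ∀ n, ∃ l : List (Literal n), l.length ≤ g n ∧
      ∀ x, List.ofFn x ∈ L ↔ l.map (Literal.eval x) ∈ L') : AC0Reducible L L' := by
  choose l hlen hl using h
  obtain ⟨p, hp⟩ := hg
  -- Working on pairs of a length and a tuple avoids transport along equalities of lengths.
  let f : (Σ n, Fin n → Bool) → List Bool := fun s => (l s.1).map (Literal.eval s.2)
  have hf : ∀ (n : ℕ) (x : Fin n → Bool), f (List.equivSigmaTuple (List.ofFn x)) =
      (l n).map (Literal.eval x) := fun n x =>
    congrArg f (List.equivSigmaTuple.apply_symm_apply ⟨n, x⟩)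
  refine ⟨fun w => f (List.equivSigmaTuple w), ⟨1, p + 1, fun n => ⟨_, Literal.circuit (l n),
    fun _ => Nat.one_pos, ?_, ?_, fun x => ?_⟩⟩, fun w => ?_⟩
  -- The summand `1` pays for the single gate, as `p` may vanish.
  · rw [Polynomial.eval_add, Polynomial.eval_one]
    exact Nat.le_add_left 1 _
  · have := (hlen n).trans (hp n)
    simp
    omega
  · exact (hf n x).trans (Literal.circuit_eval _ _).symm
  · rw [← List.ofFn_get w]
    exact (hl _ _).trans (iff_of_eq (congrArg (· ∈ L') (hf _ _).symm))

theorem mainTheorem10 (V : Pseudovariety) (hV : V ≠ Pseudovariety.all) :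
    IsNLHard (languageMembershipProblem V) := by
  obtain ⟨T, _, _, _, hT⟩ := Pseudovariety.exists_notMem hV
  -- `T` and `t₀` depend on `V` alone, so the size of `T` is a constant in all bounds.
  obtain ⟨t₀, ht₀⟩ := V.exists_not_recognizes T hT
  intro L hL
  obtain ⟨g, hg, hgraph⟩ := hL.exists_graph_compl
  have : Finite (WithOne T) := inferInstanceAs (Finite (Option T))
  have hS : PolyBounded fun n => g n * (Nat.card (WithOne T) * g n) + 1 :=
    (hg.mul ((PolyBounded.const _).mul hg)).add (.const 1)
  have hB : PolyBounded fun n => g n * g n + Nat.card T := (hg.mul hg).add (.const _)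
  -- The summands mirror `length_encode_le`, with `hS` and `hB` bounding the semigroup and the
  -- alphabet.
  refine AC0Reducible.of_literals
    (((((hS.add (.const 1)).add hB).add (.const 1)).add
      (hS.mul (hS.mul (hS.add (.const 1))))).add (hB.mul (hS.add (.const 1))) |>.add hS)
    fun n => ?_
  obtain ⟨Q, _, E, σ, τ, hQ, hE, hr⟩ := hgraph n
  have : Nonempty (ReesZero Q (WithOne T)) := ⟨.zero⟩
  obtain ⟨l, hl⟩ := IsLiteralList.encode_ofLetters
    (letter := fun x => ReesZero.letter (T := T) (E x) σ τ) {ReesZero.triple σ (t₀ : WithOne T) σ}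
    (by
      rintro (⟨a, b⟩ | x)
      · exact ⟨_, hE a b, .triple a 1 b, .zero, fun x => rfl⟩
      -- Letters from `T` have a fixed image, so the condition is vacuous.
      · exact ⟨_, .const True, .triple τ x σ, .triple τ x σ, fun x => by simp [ReesZero.letter]⟩)
  refine ⟨l, ?_, fun x => ?_⟩
  · have h1 : Nat.card (ReesZero Q (WithOne T)) ≤ g n * (Nat.card (WithOne T) * g n) + 1 :=
      ReesZero.card_le.trans (by gcongr)
    have h2 : Nat.card ((Q × Q) ⊕ T) ≤ g n * g n + Nat.card T := by
      rw [Nat.card_sum, Nat.card_prod]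
      gcongr
    have h3 := congrArg List.length (hl fun _ => false)
    rw [List.length_map] at h3
    rw [← h3]
    refine (MorphismInput.length_encode_le _).trans ?_
    simp only [MorphismInput.ofLetters]
    gcongr
  · rw [← hl, encode_mem_languageMembershipProblem_iff,
      MorphismInput.recognizes_language_ofLetters_iff, hr]
    exact (ReesZero.recognizes_loopLanguage_iff ht₀).symm
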